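/- Let $D\subseteq\mathbb C$ be a domain (a non-empty connected open set), let $\mathcal M(D)$ be the set of meromorphic functions on $D$, and let $\mathbb C_\infty=\mathbb C\cup\{\infty\}$. A family $\mathcal F\subseteq\mathcal M(D)$ is called normal in $D$ if every sequence in $\mathcal F$ has a subsequence that converges locally uniformly in $D$ with respect to the spherical (chordal) metric on $\mathbb C_\infty$; the limit function may be identically $\infty$. For $f,g\in\mathcal M(D)$ and $a\in\mathbb C_\infty$, $f$ and $g$ are said to share $a$ partially in $D$ if $\{z\in D: f(z)=a\}\subseteq\{z\in D: g(z)=a\}$. The degree of a rational function is the maximum of the degrees of its numerator and denominator in lowest terms. **Theorem.** Let $m\in\mathbb N$, let $\mathcal R$ be a family of rational functions of degree at most $m$, let $\mathcal G\subseteq\mathcal M(D)$ be normal in $D$, and let $a_1,a_2,a_3\in\mathbb C_\infty$ be three distinct values. If for each $R\in\mathcal R$ there exists $g\in\mathcal G$ such that $R$ and $g$ share $a_1$, $a_2$ and $a_3$ partially in $D$, then $\mathcal R$ is normal in $D$. The number of shared values cannot be reduced to two: in the unit disc $\mathbb D$, the family $\mathcal R=\{R_n(z)=nz : n\ge 1\}$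 consists of rational functions of degree at most $1$, the family $\mathcal G=\{g_n(z)=z^n : n\ge 1\}\subseteq\mathcal M(\mathbb D)$ is normal in $\mathbb D$, and for each $R\in\mathcal R$ there exists $g\in\mathcal G$ such that $R$ and $g$ share $0$ and $\infty$ partially in $\mathbb D$, but $\mathcal R$ is not normal in $\mathbb D$. -/

import Mathlib

open Filter Topology

/-- The value in the Riemann sphere `ℂ ∪ {∞}` of a meromorphic function `f` at `z`: the limit of
`f w`, taken in the sphere, as `w → z`, `w ≠ z`. It is `∞` at a pole and the value of the
holomorphic extension at every other point; it does not depend on the (arbitrary) complex number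
which the function `f : ℂ → ℂ` takes at `z` itself. -/
noncomputable def sphereValue (f : ℂ → ℂ) (z : ℂ) : OnePoint ℂ :=
  limUnder (𝓝[≠] z) (fun w => (f w : OnePoint ℂ))

/-- The (inverse) stereographic projection, which identifies `ℂ ∪ {∞}` with the unit sphere of the
Euclidean space `ℂ × ℝ ≅ ℝ³`. The Euclidean distance of two images is the chordal distance
`2 |z - w| / (√(1 + |z|²) √(1 + |w|²))`. -/
noncomputable def stereo : OnePoint ℂ → WithLp 2 (ℂ × ℝ)
  | OnePoint.infty => WithLp.toLp 2 (0, 1)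
  | OnePoint.some z =>
      WithLp.toLp 2 ((2 / (1 + ‖z‖ ^ 2) : ℝ) • z, (‖z‖ ^ 2 - 1) / (‖z‖ ^ 2 + 1))

/-- Spherically locally uniform convergence on `D`. -/
def TendstoSphericallyLocallyUniformlyOn
    (u : ℕ → ℂ → OnePoint ℂ) (φ : ℂ → OnePoint ℂ) (D : Set ℂ) : Prop :=
  TendstoLocallyUniformlyOn (fun n z => stereo (u n z)) (fun z => stereo (φ z)) atTop D

/-- Normality in `D`: every sequence in the family has a subsequence that converges spherically
locally uniformly in `D` (the limit is a function with values in `ℂ ∪ {∞}`, so that the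
constant `∞` is allowed). -/
def IsNormalFamily (𝓕 : Set (ℂ → ℂ)) (D : Set ℂ) : Prop :=
  ∀ u : ℕ → ℂ → ℂ, (∀ n, u n ∈ 𝓕) →
    ∃ s : ℕ → ℕ, StrictMono s ∧ ∃ φ : ℂ → OnePoint ℂ,
      TendstoSphericallyLocallyUniformlyOn (fun n => sphereValue (u (s n))) φ D

/-- `f` and `g` share `a` partially in `D`: every `a`-point of `f` in `D` is an `a`-point
of `g`. -/
def SharesPartially (f g : ℂ → ℂ) (a : OnePoint ℂ) (D : Set ℂ) : Prop :=
  {z ∈ D | sphereValue f z = a} ⊆ {z ∈ D | sphereValue g z = a}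

/-- The degree of a rational function: the larger one of the degrees of the numerator and the
denominator in lowest terms. -/
noncomputable def ratDegree (R : RatFunc ℂ) : ℕ :=
  max R.num.natDegree R.denom.natDegree

/-- A rational function as a function of a complex variable (with an arbitrary value at the
poles). -/
noncomputable def ratFun (R : RatFunc ℂ) (z : ℂ) : ℂ :=
  R.eval (RingHom.id ℂ) z

/-!
The idea is compactness of the space of rational functions of degree at most `m`. Such a function is
`[P : Q]` with a vector of coefficients of norm one (`exists_coeffs_of_ratDegree_le`), so that a
given sequence has a subsequence `[Pₙ : Qₙ]` for which `Pₙ → P₀` and `Qₙ → Q₀`, where `P₀` and `Q₀`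
are not both zero. Where `P₀` and `Q₀` have no common zero, `[Pₙ : Qₙ] → [P₀ : Q₀]` spherically
locally uniformly (`tendstoLocallyUniformlyOn_homStereo_ofFn`). It remains to exclude a common zero
`z₀ ∈ D`.

The `a`-points of `[Pₙ : Qₙ]` are the zeros of `Pₙ - a Qₙ` (of `Qₙ` if `a = ∞`), see `pointsPoly`.
At a common zero `z₀` the limit `P₀ - a Q₀` vanishes, so unless it vanishes identically,
`Pₙ - a Qₙ` has zeros arbitrarily close to `z₀` for large `n` (`eventually_exists_root_mem_ball`).
If `a` is a shared value, then the corresponding functions `gₙ` take the value `a` there as well.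
After passing to a further subsequence the `gₙ` converge spherically locally uniformly to a
continuous limit `φ`, hence `φ z₀ = a`. Since `P₀ - a Q₀` vanishes identically for at most one `a`
(`eq_zero_of_pointsPoly_eq_zero`), this applies to two of the three shared values, and `φ z₀` would
be equal to both.

With two shared values it may apply to only one of them, and indeed `n z` has, in the limit, `P₀ = z`
and `Q₀ = 0`, with the common zero `0`, where the family is not normal.
-/

/-! ### Zeros of a convergent sequence of polynomials of bounded degree -/

open Polynomial in
/-- A polynomial without zeros in a disc is controlled everywhere by its value at the centre:
each factor satisfies `|z - ζ| ≤ |z₀ - ζ| (1 + |z - z₀| / r)`, as `|z₀ - ζ| ≥ r`. -/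
theorem norm_eval_le_of_no_root_in_ball {p : ℂ[X]} {m : ℕ} (hm : p.natDegree ≤ m) {z₀ : ℂ} {r : ℝ}
    (hr : 0 < r) (h : ∀ z ∈ Metric.ball z₀ r, p.eval z ≠ 0) (z : ℂ) :
    ‖p.eval z‖ ≤ ‖p.eval z₀‖ * (1 + ‖z - z₀‖ / r) ^ m := by
  have hsplit : p.Splits := IsAlgClosed.splits p
  have hp0 : p ≠ 0 := by
    rintro rfl
    exact h z₀ (Metric.mem_ball_self hr) (by simp)
  have hK : 1 ≤ 1 + ‖z - z₀‖ / r := le_add_of_nonneg_right (by positivity)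
  have key : ∀ s : Multiset ℂ, (∀ ζ ∈ s, r ≤ ‖z₀ - ζ‖) →
      ‖(s.map fun ζ => z - ζ).prod‖ ≤
        ‖(s.map fun ζ => z₀ - ζ).prod‖ * (1 + ‖z - z₀‖ / r) ^ s.card := by
    intro s
    induction s using Multiset.induction with
    | empty => simp
    | cons ζ s ih =>
      intro hs
      have h1 := ih fun x hx => hs x (Multiset.mem_cons_of_mem hx)
      have h2 : r ≤ ‖z₀ - ζ‖ := hs ζ (Multiset.mem_cons_self ζ s)
      have h3 : ‖z - ζ‖ ≤ ‖z₀ - ζ‖ * (1 + ‖z - z₀‖ / r) := by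
        have e1 : ‖z - ζ‖ ≤ ‖z - z₀‖ + ‖z₀ - ζ‖ := by
          simpa using norm_add_le (z - z₀) (z₀ - ζ)
        have e2 : ‖z - z₀‖ ≤ ‖z₀ - ζ‖ * (‖z - z₀‖ / r) := by
          calc ‖z - z₀‖ = r * (‖z - z₀‖ / r) := by field_simp
            _ ≤ _ := by gcongr
        linarith
      simp only [Multiset.map_cons, Multiset.prod_cons, norm_mul, Multiset.card_cons, pow_succ]
      calc _ ≤ (‖z₀ - ζ‖ * (1 + ‖z - z₀‖ / r)) * (‖(s.map fun ζ => z₀ - ζ).prod‖ *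
            (1 + ‖z - z₀‖ / r) ^ s.card) := by gcongr
        _ = _ := by ring
  have hroots : ∀ ζ ∈ p.roots, r ≤ ‖z₀ - ζ‖ := by
    intro ζ hζ
    by_contra! hlt
    refine h ζ ?_ ((mem_roots hp0).1 hζ)
    rwa [Metric.mem_ball, dist_comm, dist_eq_norm]
  rw [hsplit.eval_eq_prod_roots z, hsplit.eval_eq_prod_roots z₀, norm_mul, norm_mul, mul_assoc]
  gcongr
  refine (key _ hroots).trans ?_
  gcongr
  exact (card_roots' p).trans hm

open Polynomial in
/-- Hurwitz's theorem for polynomials of bounded degree: a zero of the limit `q ≠ 0` attracts zeros.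
Along a subsequence without zeros in the disc, `norm_eval_le_of_no_root_in_ball` would give
`q = 0`. -/
theorem eventually_exists_root_mem_ball {p : ℕ → ℂ[X]} {m : ℕ} (hm : ∀ n, (p n).natDegree ≤ m)
    {q : ℂ[X]} (hq : q ≠ 0) (hlim : ∀ z, Tendsto (fun n => (p n).eval z) atTop (𝓝 (q.eval z)))
    {z₀ : ℂ} (h₀ : q.eval z₀ = 0) {r : ℝ} (hr : 0 < r) :
    ∀ᶠ n in atTop, ∃ z ∈ Metric.ball z₀ r, (p n).eval z = 0 := by
  by_contra hcon
  rw [not_eventually] at hcon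
  obtain ⟨s, hs, hroot⟩ := extraction_of_frequently_atTop hcon
  refine hq (Polynomial.funext fun z => ?_)
  have h1 := ((hlim z).comp hs.tendsto_atTop).norm
  have h2 := (((hlim z₀).comp hs.tendsto_atTop).norm).mul_const ((1 + ‖z - z₀‖ / r) ^ m)
  have h3 := le_of_tendsto_of_tendsto' h1 h2 fun n =>
    norm_eval_le_of_no_root_in_ball (hm (s n)) hr
      (fun w hw h0 => hroot n ⟨w, hw, h0⟩) z
  rw [h₀, norm_zero, zero_mul] at h3
  simpa using h3

/-! ### The stereographic projection -/

/-- The point `[p : q]` of the Riemann sphere: `p / q`, and `∞` if `q = 0`. The value `∞` at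
`p = q = 0` is meaningless. -/
noncomputable def sphereRatio (p q : ℂ) : OnePoint ℂ :=
  open Classical in if q = 0 then OnePoint.infty else ((p / q : ℂ) : OnePoint ℂ)

/-- The stereographic image of `[p : q]` in homogeneous coordinates, where it is a manifestly
continuous function of `(p, q) ≠ (0, 0)`. -/
noncomputable def homStereo (p q : ℂ) : WithLp 2 (ℂ × ℝ) :=
  WithLp.toLp 2 ((2 / (‖p‖ ^ 2 + ‖q‖ ^ 2) : ℝ) • (p * (starRingEnd ℂ) q),
    (‖p‖ ^ 2 - ‖q‖ ^ 2) / (‖p‖ ^ 2 + ‖q‖ ^ 2))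

theorem norm_sq_add_norm_sq_ne_zero {p q : ℂ} (h : p ≠ 0 ∨ q ≠ 0) : ‖p‖ ^ 2 + ‖q‖ ^ 2 ≠ 0 := by
  rcases h with h | h
  · have := norm_pos_iff.2 h
    positivity
  · have := norm_pos_iff.2 h
    positivity

theorem stereo_sphereRatio {p q : ℂ} (h : p ≠ 0 ∨ q ≠ 0) :
    stereo (sphereRatio p q) = homStereo p q := by
  by_cases hq : q = 0
  · subst hq
    have hp : p ≠ 0 := by simpa using h
    have : ‖p‖ ^ 2 ≠ 0 := by simpa using hp
    simp [sphereRatio, homStereo, stereo, this]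
  · have hq' : (0 : ℝ) < ‖q‖ := norm_pos_iff.2 hq
    have hs := norm_sq_add_norm_sq_ne_zero h
    have hconj : q * (starRingEnd ℂ) q = ((‖q‖ ^ 2 : ℝ) : ℂ) := by
      rw [Complex.mul_conj, Complex.normSq_eq_norm_sq]
    simp only [sphereRatio, if_neg hq, homStereo]
    change WithLp.toLp 2 _ = _
    congr 2
    · have e : (starRingEnd ℂ) q = ((‖q‖ ^ 2 : ℝ) : ℂ) / q := by
        rw [← hconj]
        field_simp
      have e2 : (2 / (1 + ‖p / q‖ ^ 2) : ℝ) = 2 / (‖p‖ ^ 2 + ‖q‖ ^ 2) * ‖q‖ ^ 2 := by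
        rw [norm_div]
        have : 1 + (‖p‖ / ‖q‖) ^ 2 = (‖p‖ ^ 2 + ‖q‖ ^ 2) / ‖q‖ ^ 2 := by
          field_simp
          ring
        rw [this]
        field_simp
      rw [e, e2, Complex.real_smul, Complex.real_smul]
      push_cast
      ring
    · rw [norm_div]
      have h1 : (‖p‖ / ‖q‖) ^ 2 - 1 = (‖p‖ ^ 2 - ‖q‖ ^ 2) / ‖q‖ ^ 2 := by field_simp
      have h2 : (‖p‖ / ‖q‖) ^ 2 + 1 = (‖p‖ ^ 2 + ‖q‖ ^ 2) / ‖q‖ ^ 2 := by field_simp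
      rw [h1, h2]
      field_simp

theorem continuousAt_homStereo {x : ℂ × ℂ} (h : x.1 ≠ 0 ∨ x.2 ≠ 0) :
    ContinuousAt (fun y : ℂ × ℂ => homStereo y.1 y.2) x := by
  have hs := norm_sq_add_norm_sq_ne_zero h
  have hd : ContinuousAt (fun y : ℂ × ℂ => ‖y.1‖ ^ 2 + ‖y.2‖ ^ 2) x := by fun_prop
  have hc : ContinuousAt (fun y : ℂ × ℂ => (starRingEnd ℂ) y.2) x :=
    Complex.continuous_conj.continuousAt.comp continuousAt_snd
  have h1 : ContinuousAt (fun y : ℂ × ℂ =>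
      (2 / (‖y.1‖ ^ 2 + ‖y.2‖ ^ 2) : ℝ) • (y.1 * (starRingEnd ℂ) y.2)) x :=
    (continuousAt_const.div hd hs).smul (continuousAt_fst.mul hc)
  have h2 : ContinuousAt (fun y : ℂ × ℂ =>
      (‖y.1‖ ^ 2 - ‖y.2‖ ^ 2) / (‖y.1‖ ^ 2 + ‖y.2‖ ^ 2)) x :=
    ContinuousAt.div (by fun_prop) hd hs
  exact (WithLp.prod_continuous_toLp 2 ℂ ℝ).continuousAt.comp (h1.prodMk h2)

theorem continuous_stereo : Continuous stereo := by
  -- In homogeneous coordinates, `z = [z : 1]` near a finite point and `z = [1 : z⁻¹]` near `∞`.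
  rw [continuous_iff_continuousAt]
  intro x
  induction x using OnePoint.rec with
  | infty =>
    rw [OnePoint.continuousAt_infty', Filter.coclosedCompact_eq_cocompact,
      ← Metric.cobounded_eq_cocompact]
    have h1 : Tendsto (fun z : ℂ => ((1 : ℂ), z⁻¹)) (Bornology.cobounded ℂ) (𝓝 ((1 : ℂ), (0 : ℂ))) :=
      tendsto_const_nhds.prodMk_nhds tendsto_inv₀_cobounded
    have h2 := (continuousAt_homStereo (x := ((1 : ℂ), (0 : ℂ))) (Or.inl one_ne_zero)).tendsto.comp h1
    have h3 : homStereo 1 0 = stereo OnePoint.infty := by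
      rw [← stereo_sphereRatio (Or.inl one_ne_zero)]
      simp [sphereRatio]
    rw [← h3]
    refine h2.congr' ?_
    have hne : ∀ᶠ z : ℂ in Bornology.cobounded ℂ, z ≠ 0 := Bornology.eventually_ne_cobounded 0
    filter_upwards [hne] with z hz
    simp only [Function.comp_apply]
    rw [← stereo_sphereRatio (Or.inl one_ne_zero)]
    simp [sphereRatio, hz]
  | coe z =>
    rw [OnePoint.continuousAt_coe]
    have h1 : ContinuousAt (fun w : ℂ => homStereo w 1) z :=
      (continuousAt_homStereo (x := (z, (1 : ℂ))) (Or.inr one_ne_zero)).comp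
        (f := fun w : ℂ => (w, (1 : ℂ))) (by fun_prop)
    convert h1 using 1
    ext1 w
    rw [← stereo_sphereRatio (Or.inr one_ne_zero)]
    simp [sphereRatio]

theorem stereo_injective : Function.Injective stereo := by
  have hne : ∀ z : ℂ, stereo OnePoint.infty ≠ stereo (z : OnePoint ℂ) := by
    intro z h
    have h2 : (1 : ℝ) = (‖z‖ ^ 2 - 1) / (‖z‖ ^ 2 + 1) := congrArg (fun x => x.snd) h
    have : ‖z‖ ^ 2 + 1 ≠ 0 := by positivity
    field_simp at h2
    linarith
  intro x y h
  induction x using OnePoint.rec with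
  | infty =>
    induction y using OnePoint.rec with
    | infty => rfl
    | coe w => exact absurd h (hne w)
  | coe z =>
    induction y using OnePoint.rec with
    | infty => exact absurd h.symm (hne z)
    | coe w =>
      have h1 : (2 / (1 + ‖z‖ ^ 2) : ℝ) • z = (2 / (1 + ‖w‖ ^ 2) : ℝ) • w :=
        congrArg (fun x => x.fst) h
      have h2 : (‖z‖ ^ 2 - 1) / (‖z‖ ^ 2 + 1) = (‖w‖ ^ 2 - 1) / (‖w‖ ^ 2 + 1) :=
        congrArg (fun x => x.snd) h
      have h3 : ‖z‖ ^ 2 = ‖w‖ ^ 2 := by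
        rw [div_eq_div_iff (by positivity) (by positivity)] at h2
        linarith
      rw [h3] at h1
      have h4 : (2 / (1 + ‖w‖ ^ 2) : ℝ) ≠ 0 := by positivity
      rw [smul_right_injective ℂ h4 h1]

/-! ### Values of meromorphic functions in the sphere -/

theorem sphereValue_eq_of_tendsto {f : ℂ → ℂ} {z : ℂ} {a : OnePoint ℂ}
    (h : Tendsto (fun w => (f w : OnePoint ℂ)) (𝓝[≠] z) (𝓝 a)) : sphereValue f z = a :=
  h.limUnder_eq

theorem sphereValue_eq_of_continuousAt {f : ℂ → ℂ} {z : ℂ} (h : ContinuousAt f z) :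
    sphereValue f z = f z :=
  sphereValue_eq_of_tendsto <|
    (OnePoint.continuous_coe.continuousAt.comp h).tendsto.mono_left nhdsWithin_le_nhds

theorem tendsto_coe_infty_of_cobounded {f : ℂ → ℂ} {l : Filter ℂ}
    (h : Tendsto f l (Bornology.cobounded ℂ)) :
    Tendsto (fun w => (f w : OnePoint ℂ)) l (𝓝 OnePoint.infty) := by
  refine OnePoint.tendsto_coe_infty.comp ?_
  rwa [Filter.coclosedCompact_eq_cocompact, ← Metric.cobounded_eq_cocompact]

theorem MeromorphicAt.tendsto_sphereValue {f : ℂ → ℂ} {z : ℂ} (hf : MeromorphicAt f z) :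
    Tendsto (fun w => (f w : OnePoint ℂ)) (𝓝[≠] z) (𝓝 (sphereValue f z)) := by
  obtain ⟨a, ha⟩ : ∃ a : OnePoint ℂ, Tendsto (fun w => (f w : OnePoint ℂ)) (𝓝[≠] z) (𝓝 a) := by
    rcases lt_or_ge (meromorphicOrderAt f z) 0 with h | h
    · exact ⟨_, tendsto_coe_infty_of_cobounded
        ((tendsto_cobounded_iff_meromorphicOrderAt_neg hf).2 h)⟩
    · obtain ⟨c, hc⟩ := (tendsto_nhds_iff_meromorphicOrderAt_nonneg hf).2 h
      exact ⟨c, (OnePoint.continuous_coe.tendsto c).comp hc⟩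
  rwa [sphereValue_eq_of_tendsto ha]

theorem MeromorphicAt.continuousAt_sphereValue {f : ℂ → ℂ} {z : ℂ} (hf : MeromorphicAt f z) :
    ContinuousAt (sphereValue f) z := by
  rw [continuousAt_iff_punctured_nhds]
  refine hf.tendsto_sphereValue.congr' ?_
  filter_upwards [hf.eventually_analyticAt] with w hw
  exact (sphereValue_eq_of_continuousAt hw.continuousAt).symm

theorem MeromorphicOn.continuousOn_stereo_sphereValue {f : ℂ → ℂ} {D : Set ℂ}
    (hf : MeromorphicOn f D) : ContinuousOn (fun z => stereo (sphereValue f z)) D := fun z hz =>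
  (continuous_stereo.continuousAt.comp (hf z hz).continuousAt_sphereValue).continuousWithinAt

/-! ### Rational functions of bounded degree as coefficient vectors -/

theorem eval_num_ne_zero_or (R : RatFunc ℂ) (z : ℂ) :
    R.num.eval z ≠ 0 ∨ R.denom.eval z ≠ 0 := by
  by_contra! h0
  obtain ⟨u, v, huv⟩ := R.isCoprime_num_denom
  simpa [h0] using congrArg (Polynomial.eval z) huv

open Polynomial in
theorem sphereValue_ratFun (R : RatFunc ℂ) (z : ℂ) :
    sphereValue (ratFun R) z = sphereRatio (R.num.eval z) (R.denom.eval z) := by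
  have hR : ∀ w, ratFun R w = R.num.eval w / R.denom.eval w := fun w => rfl
  by_cases hz : R.denom.eval z = 0
  · rw [sphereRatio, if_pos hz]
    refine sphereValue_eq_of_tendsto (tendsto_coe_infty_of_cobounded ?_)
    have hnum : R.num.eval z ≠ 0 := (eval_num_ne_zero_or R z).resolve_right (not_not.2 hz)
    have hden : Tendsto (fun w => R.denom.eval w) (𝓝[≠] z) (𝓝[≠] 0) := by
      refine tendsto_nhdsWithin_iff.2 ⟨?_, ?_⟩
      · have := R.denom.continuous.tendsto z
        rw [hz] at this
        exact this.mono_left nhdsWithin_le_nhds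
      · have hfin : {w | R.denom.IsRoot w}.Finite := R.denom.finite_setOfPred_isRoot R.denom_ne_zero
        have := hfin.subset (Set.sdiff_subset (t := {z}))
        filter_upwards [nhdsWithin_le_nhds (this.isClosed.isOpen_compl.mem_nhds (by simp)),
          self_mem_nhdsWithin] with w hw hwz h0
        exact hw ⟨h0, hwz⟩
    have hinv := tendsto_inv₀_nhdsNE_zero.comp hden
    have h2 := (R.num.continuous.tendsto z).mono_left (nhdsWithin_le_nhds (s := {z}ᶜ))
    rw [← tendsto_norm_atTop_iff_cobounded] at hinv ⊢
    refine (h2.norm.pos_mul_atTop (norm_pos_iff.2 hnum) hinv).congr fun w => ?_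
    rw [hR, div_eq_mul_inv, norm_mul]
    rfl
  · rw [sphereRatio, if_neg hz, ← hR]
    exact sphereValue_eq_of_continuousAt
      (R.num.continuous.continuousAt.div R.denom.continuous.continuousAt hz)

open Polynomial in
theorem continuous_eval_ofFn (n : ℕ) :
    Continuous fun x : (Fin n → ℂ) × ℂ => (ofFn n x.1).eval x.2 := by
  simp only [ofFn_eq_sum_monomial, eval_finsetSum, eval_monomial]
  fun_prop

open Polynomial in
/-- Every rational function of degree at most `m` is represented by a coefficient vector
`(c₁, c₂)` of norm one: it takes the value `[p(z) : q(z)]`, where `p` and `q` have the coefficients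
`c₁` and `c₂` and no common zero. -/
theorem exists_coeffs_of_ratDegree_le {R : RatFunc ℂ} {m : ℕ} (hR : ratDegree R ≤ m) :
    ∃ c ∈ Metric.sphere (0 : (Fin (m + 1) → ℂ) × (Fin (m + 1) → ℂ)) 1,
      ∀ z, ((ofFn (m + 1) c.1).eval z ≠ 0 ∨ (ofFn (m + 1) c.2).eval z ≠ 0) ∧
        sphereValue (ratFun R) z =
          sphereRatio ((ofFn (m + 1) c.1).eval z) ((ofFn (m + 1) c.2).eval z) := by
  have hnum : ofFn (m + 1) (toFn (m + 1) R.num) = R.num :=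
    ofFn_comp_toFn_eq_id_of_natDegree_lt
      (Nat.lt_succ_of_le ((le_max_left _ _).trans hR))
  have hden : ofFn (m + 1) (toFn (m + 1) R.denom) = R.denom :=
    ofFn_comp_toFn_eq_id_of_natDegree_lt
      (Nat.lt_succ_of_le ((le_max_right _ _).trans hR))
  set b : (Fin (m + 1) → ℂ) × (Fin (m + 1) → ℂ) := (toFn (m + 1) R.num, toFn (m + 1) R.denom)
    with hb
  have hb0 : b ≠ 0 := by
    intro h0
    have h1 : toFn (m + 1) R.denom = 0 := congrArg Prod.snd h0
    rw [h1, map_zero] at hden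
    exact R.denom_ne_zero hden.symm
  have hl : ((‖b‖⁻¹ : ℝ) : ℂ) ≠ 0 := by simpa using hb0
  set l : ℂ := ((‖b‖⁻¹ : ℝ) : ℂ) with hldef
  have h1 : ofFn (m + 1) (l • b).1 = l • R.num := by
    rw [Prod.smul_fst, map_smul, hnum]
  have h2 : ofFn (m + 1) (l • b).2 = l • R.denom := by
    rw [Prod.smul_snd, map_smul, hden]
  refine ⟨l • b, ?_, fun z => ?_⟩
  · rw [mem_sphere_zero_iff_norm, norm_smul, hldef, Complex.norm_real, norm_inv, norm_norm,
      inv_mul_cancel₀ (norm_ne_zero_iff.2 hb0)]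
  · rw [h1, h2, sphereValue_ratFun, eval_smul, eval_smul, smul_eq_mul, smul_eq_mul]
    constructor
    · exact (eval_num_ne_zero_or R z).imp (mul_ne_zero hl) (mul_ne_zero hl)
    · simp only [sphereRatio, mul_eq_zero, hl, false_or, mul_div_mul_left _ _ hl]

open Polynomial in
/-- Where the limit pair has no common zero, convergence of the coefficients forces spherically
locally uniform convergence of the quotients. -/
theorem tendstoLocallyUniformlyOn_homStereo_ofFn {n : ℕ}
    {c : ℕ → (Fin n → ℂ) × (Fin n → ℂ)} {c₀ : (Fin n → ℂ) × (Fin n → ℂ)}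
    (hc : Tendsto c atTop (𝓝 c₀)) {D : Set ℂ}
    (hD : ∀ z ∈ D, (ofFn n c₀.1).eval z ≠ 0 ∨ (ofFn n c₀.2).eval z ≠ 0) :
    TendstoLocallyUniformlyOn
      (fun k z => homStereo ((ofFn n (c k).1).eval z) ((ofFn n (c k).2).eval z))
      (fun z => homStereo ((ofFn n c₀.1).eval z) ((ofFn n c₀.2).eval z)) atTop D := by
  rw [Metric.tendstoLocallyUniformlyOn_iff]
  intro ε hε z hz
  have hcont : ContinuousAt (fun x : ((Fin n → ℂ) × (Fin n → ℂ)) × ℂ =>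
      homStereo ((ofFn n x.1.1).eval x.2) ((ofFn n x.1.2).eval x.2)) (c₀, z) := by
    have h1 : Continuous fun x : ((Fin n → ℂ) × (Fin n → ℂ)) × ℂ => (ofFn n x.1.1).eval x.2 :=
      (continuous_eval_ofFn n).comp (f := fun x : ((Fin n → ℂ) × (Fin n → ℂ)) × ℂ =>
        (x.1.1, x.2)) (by fun_prop)
    have h2 : Continuous fun x : ((Fin n → ℂ) × (Fin n → ℂ)) × ℂ => (ofFn n x.1.2).eval x.2 :=
      (continuous_eval_ofFn n).comp (f := fun x : ((Fin n → ℂ) × (Fin n → ℂ)) × ℂ =>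
        (x.1.2, x.2)) (by fun_prop)
    exact ContinuousAt.comp (f := fun x : ((Fin n → ℂ) × (Fin n → ℂ)) × ℂ =>
      ((ofFn n x.1.1).eval x.2, (ofFn n x.1.2).eval x.2)) (continuousAt_homStereo (hD z hz))
      (h1.prodMk h2).continuousAt
  have hev := hcont.eventually (Metric.ball_mem_nhds _ (half_pos hε))
  rw [nhds_prod_eq, Filter.eventually_prod_iff] at hev
  obtain ⟨U, hU, V, hV, hUV⟩ := hev
  refine ⟨{w | V w}, nhdsWithin_le_nhds hV, ?_⟩
  filter_upwards [hc.eventually hU] with k hk w hw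
  exact dist_triangle_right _ _ _ |>.trans_lt
    ((add_lt_add (hUV hU.self_of_nhds hw) (hUV hk hw)).trans_eq (add_halves ε))

/-! ### The polynomial of the `a`-points -/

open Polynomial in
/-- The polynomial whose zeros are the `a`-points of `p / q`: `p - a q`, and `q` if `a = ∞`. -/
noncomputable def pointsPoly (a : OnePoint ℂ) (p q : ℂ[X]) : ℂ[X] :=
  match a with
  | OnePoint.infty => q
  | OnePoint.some a => p - C a * q

open Polynomial in
theorem natDegree_pointsPoly_le (a : OnePoint ℂ) {p q : ℂ[X]} {m : ℕ} (hp : p.natDegree ≤ m)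
    (hq : q.natDegree ≤ m) : (pointsPoly a p q).natDegree ≤ m := by
  induction a using OnePoint.rec with
  | infty => exact hq
  | coe a =>
    exact (natDegree_sub_le_of_le hp ((natDegree_C_mul_le a q).trans hq)).trans (max_self m).le

open Polynomial in
theorem tendsto_eval_pointsPoly (a : OnePoint ℂ) {p q : ℕ → ℂ[X]} {p₀ q₀ : ℂ[X]} {z : ℂ}
    (hp : Tendsto (fun n => (p n).eval z) atTop (𝓝 (p₀.eval z)))
    (hq : Tendsto (fun n => (q n).eval z) atTop (𝓝 (q₀.eval z))) :
    Tendsto (fun n => (pointsPoly a (p n) (q n)).eval z) atTop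
      (𝓝 ((pointsPoly a p₀ q₀).eval z)) := by
  induction a using OnePoint.rec with
  | infty => exact hq
  | coe a =>
    change Tendsto (fun n => (p n - C a * q n).eval z) atTop (𝓝 ((p₀ - C a * q₀).eval z))
    simpa using hp.sub (hq.const_mul a)

open Polynomial in
theorem eval_pointsPoly_eq_zero (a : OnePoint ℂ) {p q : ℂ[X]} {z : ℂ} (hp : p.eval z = 0)
    (hq : q.eval z = 0) : (pointsPoly a p q).eval z = 0 := by
  induction a using OnePoint.rec with
  | infty => exact hq
  | coe a =>
    change (p - C a * q).eval z = 0
    simp [hp, hq]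

open Polynomial in
theorem sphereRatio_eq_of_eval_pointsPoly_eq_zero {a : OnePoint ℂ} {p q : ℂ[X]} {z : ℂ}
    (hpq : p.eval z ≠ 0 ∨ q.eval z ≠ 0) (h : (pointsPoly a p q).eval z = 0) :
    sphereRatio (p.eval z) (q.eval z) = a := by
  induction a using OnePoint.rec with
  | infty => exact if_pos h
  | coe a =>
    change (p - C a * q).eval z = 0 at h
    have h1 : p.eval z = a * q.eval z := by simpa [sub_eq_zero] using h
    have hq : q.eval z ≠ 0 := fun h0 => by simp [h0, h1] at hpq
    rw [sphereRatio, if_neg hq, h1, mul_div_cancel_right₀ _ hq]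

open Polynomial in
theorem eq_zero_of_pointsPoly_eq_zero {a b : OnePoint ℂ} (hab : a ≠ b) {p q : ℂ[X]}
    (ha : pointsPoly a p q = 0) (hb : pointsPoly b p q = 0) : p = 0 ∧ q = 0 := by
  induction a using OnePoint.rec with
  | infty =>
    induction b using OnePoint.rec with
    | infty => exact absurd rfl hab
    | coe b =>
      change q = 0 at ha
      change p - C b * q = 0 at hb
      simp_all
  | coe a =>
    change p - C a * q = 0 at ha
    induction b using OnePoint.rec with
    | infty =>
      change q = 0 at hb
      simp_all
    | coe b =>
      change p - C b * q = 0 at hb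
      have h1 : C (a - b) * q = 0 := by
        rw [C_sub]
        linear_combination hb - ha
      have hq : q = 0 := (mul_eq_zero.1 h1).resolve_left
        (by simpa [sub_eq_zero] using fun h => hab (congrArg _ h))
      exact ⟨by simpa [hq] using ha, hq⟩

/-! ### The normality criterion -/

/-- A locally uniform limit of the functions `G n` takes at `z₀` the value which the `G n` take
at points arbitrarily close to `z₀`. -/
theorem TendstoLocallyUniformlyOn.eq_of_eventually_exists {X Y : Type*} [TopologicalSpace X]
    [MetricSpace Y] {G : ℕ → X → Y} {ψ : X → Y} {D : Set X} (hD : IsOpen D)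
    (hG : TendstoLocallyUniformlyOn G ψ atTop D) (hψ : ContinuousOn ψ D) {z₀ : X} (hz₀ : z₀ ∈ D)
    {a : Y} (h : ∀ t ∈ 𝓝 z₀, ∀ᶠ n in atTop, ∃ z ∈ t, G n z = a) : ψ z₀ = a := by
  refine eq_of_forall_dist_le fun ε hε => ?_
  obtain ⟨t, ht, hev⟩ := Metric.tendstoLocallyUniformlyOn_iff.1 hG (ε / 2) (half_pos hε) z₀ hz₀
  rw [hD.nhdsWithin_eq hz₀] at ht
  have hc := (hψ.continuousAt (hD.mem_nhds hz₀)).eventually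
    (Metric.ball_mem_nhds (ψ z₀) (half_pos hε))
  obtain ⟨n, ⟨z, ⟨hzt, hzc⟩, hza⟩, hn⟩ := ((h _ (inter_mem ht hc)).and hev).exists
  have h1 := hn z hzt
  rw [hza] at h1
  have h2 : dist (ψ z) (ψ z₀) < ε / 2 := hzc
  linarith [dist_triangle_left (ψ z₀) a (ψ z)]

open Polynomial in
theorem isNormalFamily_of_sharesPartially {D : Set ℂ} (hD : IsOpen D) {m : ℕ}
    {𝓡 : Set (RatFunc ℂ)} {𝓖 : Set (ℂ → ℂ)} {a₁ a₂ a₃ : OnePoint ℂ}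
    (h𝓡 : ∀ R ∈ 𝓡, ratDegree R ≤ m) (h𝓖 : ∀ g ∈ 𝓖, MeromorphicOn g D)
    (h₁₂ : a₁ ≠ a₂) (h₁₃ : a₁ ≠ a₃) (h₂₃ : a₂ ≠ a₃) (hnorm : IsNormalFamily 𝓖 D)
    (hshare : ∀ R ∈ 𝓡, ∃ g ∈ 𝓖, SharesPartially (ratFun R) g a₁ D ∧
      SharesPartially (ratFun R) g a₂ D ∧ SharesPartially (ratFun R) g a₃ D) :
    IsNormalFamily (ratFun '' 𝓡) D := by
  intro u hu
  choose R hR hRu using hu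
  choose g hg hga using fun n => hshare (R n) (hR n)
  choose c hc hcz using fun n => exists_coeffs_of_ratDegree_le (h𝓡 (R n) (hR n))
  obtain ⟨s, hs, φ, hφ⟩ := hnorm g hg
  obtain ⟨c₀, hc₀, t, ht, hlim⟩ :=
    (isCompact_sphere (0 : (Fin (m + 1) → ℂ) × (Fin (m + 1) → ℂ)) 1).tendsto_subseq
      (fun n => hc (s n))
  set P : ℕ → ℂ[X] := fun n => ofFn (m + 1) (c (s (t n))).1 with hP
  set Q : ℕ → ℂ[X] := fun n => ofFn (m + 1) (c (s (t n))).2 with hQ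
  set P₀ : ℂ[X] := ofFn (m + 1) c₀.1 with hP₀
  set Q₀ : ℂ[X] := ofFn (m + 1) c₀.2 with hQ₀
  have hlim' : Tendsto (fun n => c (s (t n))) atTop (𝓝 c₀) := hlim
  have hPlim : ∀ z, Tendsto (fun n => (P n).eval z) atTop (𝓝 (P₀.eval z)) := fun z =>
    ((continuous_eval_ofFn (m + 1)).tendsto (c₀.1, z)).comp
      (((continuous_fst.tendsto c₀).comp hlim').prodMk_nhds tendsto_const_nhds)
  have hQlim : ∀ z, Tendsto (fun n => (Q n).eval z) atTop (𝓝 (Q₀.eval z)) := fun z =>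
    ((continuous_eval_ofFn (m + 1)).tendsto (c₀.2, z)).comp
      (((continuous_snd.tendsto c₀).comp hlim').prodMk_nhds tendsto_const_nhds)
  have hdeg : ∀ v : Fin (m + 1) → ℂ, (ofFn (m + 1) v).natDegree ≤ m := fun v =>
    Nat.le_of_lt_succ (ofFn_natDegree_lt (Nat.succ_pos m) v)
  have hψ : TendstoLocallyUniformlyOn (fun n z => stereo (sphereValue (g (s (t n))) z))
      (fun z => stereo (φ z)) atTop D := fun U hU x hx => by
    obtain ⟨v, hv, hev⟩ := hφ U hU x hx
    exact ⟨v, hv, ht.tendsto_atTop.eventually hev⟩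
  have hψc : ContinuousOn (fun z => stereo (φ z)) D := hψ.continuousOn <|
    Frequently.of_forall fun n => (h𝓖 _ (hg (s (t n)))).continuousOn_stereo_sphereValue
  have hvalue : ∀ z₀ ∈ D, P₀.eval z₀ = 0 → Q₀.eval z₀ = 0 → ∀ a : OnePoint ℂ,
      (∀ n, SharesPartially (ratFun (R n)) (g n) a D) →
      pointsPoly a P₀ Q₀ ≠ 0 → φ z₀ = a := by
    intro z₀ hz₀ hp hq a ha hne
    -- `P₀ - a Q₀` vanishes at `z₀`, so the `a`-points of the rational functions accumulate at `z₀`,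
    -- and these are `a`-points of the functions `g`.
    refine stereo_injective (hψ.eq_of_eventually_exists hD hψc hz₀ fun v hv => ?_)
    obtain ⟨r, hr, hrv⟩ := Metric.mem_nhds_iff.1 (inter_mem hv (hD.mem_nhds hz₀))
    filter_upwards [eventually_exists_root_mem_ball
      (fun n => natDegree_pointsPoly_le a (hdeg (c (s (t n))).1) (hdeg (c (s (t n))).2)) hne
      (fun z => tendsto_eval_pointsPoly a (hPlim z) (hQlim z))
      (eval_pointsPoly_eq_zero a hp hq) hr] with n hn
    obtain ⟨z, hz, hroot⟩ := hn
    have hRz : sphereValue (ratFun (R (s (t n)))) z = a := by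
      rw [(hcz (s (t n)) z).2]
      exact sphereRatio_eq_of_eval_pointsPoly_eq_zero (hcz (s (t n)) z).1 hroot
    exact ⟨z, (hrv hz).1, congrArg stereo (ha (s (t n)) ⟨(hrv hz).2, hRz⟩).2⟩
  -- At a common zero, `φ` would take two of the three values, since at most one of the three
  -- polynomials `pointsPoly aᵢ P₀ Q₀` is zero.
  have hcoprime : ∀ z ∈ D, P₀.eval z ≠ 0 ∨ Q₀.eval z ≠ 0 := by
    intro z hz
    by_contra! h0
    have hv₁ := hvalue z hz h0.1 h0.2 a₁ fun n => (hga n).1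
    have hv₂ := hvalue z hz h0.1 h0.2 a₂ fun n => (hga n).2.1
    have hv₃ := hvalue z hz h0.1 h0.2 a₃ fun n => (hga n).2.2
    have hzero : ∀ {a b : OnePoint ℂ}, a ≠ b → pointsPoly a P₀ Q₀ = 0 →
        pointsPoly b P₀ Q₀ ≠ 0 := by
      intro a b hab ha hb
      obtain ⟨hp, hq⟩ := eq_zero_of_pointsPoly_eq_zero hab ha hb
      have e : c₀ = 0 := Prod.ext
        (injective_ofFn (m + 1) (hp.trans (map_zero _).symm))
        (injective_ofFn (m + 1) (hq.trans (map_zero _).symm))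
      rw [e] at hc₀
      simp at hc₀
    by_cases k₁ : pointsPoly a₁ P₀ Q₀ = 0
    · exact h₂₃ ((hv₂ (hzero h₁₂ k₁)).symm.trans (hv₃ (hzero h₁₃ k₁)))
    · by_cases k₂ : pointsPoly a₂ P₀ Q₀ = 0
      · exact h₁₃ ((hv₁ k₁).symm.trans (hv₃ (hzero h₂₃ k₂)))
      · exact h₁₂ ((hv₁ k₁).symm.trans (hv₂ k₂))
  refine ⟨s ∘ t, hs.comp ht, fun z => sphereRatio (P₀.eval z) (Q₀.eval z), ?_⟩
  refine ((tendstoLocallyUniformlyOn_homStereo_ofFn hlim' hcoprime).congr ?_).congr_right ?_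
  · intro n z hz
    simp only [Function.comp_apply]
    rw [← hRu, (hcz (s (t n)) z).2, stereo_sphereRatio (hcz (s (t n)) z).1]
  · intro z hz
    exact (stereo_sphereRatio (hcoprime z hz)).symm

/-! ### Two values do not suffice: `n z` and `z ^ n` in the unit disc -/

theorem sphereValue_pow (n : ℕ) (z : ℂ) :
    sphereValue (fun w => w ^ n) z = ((z ^ n : ℂ) : OnePoint ℂ) :=
  sphereValue_eq_of_continuousAt (continuous_pow n).continuousAt

theorem isNormalFamily_pow_ball :
    IsNormalFamily {g | ∃ n : ℕ, 1 ≤ n ∧ g = fun z => z ^ n} (Metric.ball 0 1) := by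
  intro u hu
  choose k hk hku using hu
  -- Either an exponent recurs, and a subsequence is constant, or the exponents tend to infinity,
  -- and the whole sequence converges to zero.
  by_cases h : ∃ N, ∃ᶠ n in atTop, k n = N
  · obtain ⟨N, hN⟩ := h
    obtain ⟨s, hs, hsN⟩ := extraction_of_frequently_atTop hN
    refine ⟨s, hs, sphereValue fun z => z ^ N, fun U hU x _ =>
      ⟨_, self_mem_nhdsWithin, Eventually.of_forall fun n y _ => ?_⟩⟩
    simp only [hku, hsN]
    exact refl_mem_uniformity hU
  · have htop : Tendsto k atTop atTop := by
      refine le_trans (le_cofinite_iff_eventually_ne.2 fun N => ?_) Nat.cofinite_eq_atTop.le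
      rw [eventually_map]
      exact not_frequently.1 fun hN => h ⟨N, hN⟩
    refine ⟨id, strictMono_id, fun _ => ((0 : ℂ) : OnePoint ℂ), ?_⟩
    refine Metric.tendstoLocallyUniformlyOn_iff.2 fun ε hε x hx => ?_
    have hc : ContinuousAt (fun w : ℂ => stereo w) 0 :=
      (continuous_stereo.comp OnePoint.continuous_coe).continuousAt
    obtain ⟨δ, hδ, hball⟩ := Metric.continuousAt_iff.1 hc ε hε
    obtain ⟨r, hxr, hr1⟩ := exists_between (mem_ball_zero_iff.1 hx)
    have hr0 : 0 ≤ r := (norm_nonneg x).trans hxr.le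
    refine ⟨Metric.ball 0 r, nhdsWithin_le_nhds
      (Metric.isOpen_ball.mem_nhds (mem_ball_zero_iff.2 hxr)), ?_⟩
    have hpow := (tendsto_pow_atTop_nhds_zero_of_lt_one hr0 hr1).comp htop
    filter_upwards [hpow.eventually (gt_mem_nhds hδ)] with n hn y hy
    simp only [id, hku, sphereValue_pow]
    rw [dist_comm]
    refine hball ?_
    rw [dist_zero_right, norm_pow]
    exact (pow_le_pow_left₀ (norm_nonneg y) (mem_ball_zero_iff.1 hy).le _).trans_lt hn

theorem ratFun_C_mul_X (a z : ℂ) : ratFun (RatFunc.C a * RatFunc.X) z = a * z := by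
  rw [show RatFunc.C a * RatFunc.X = algebraMap (Polynomial ℂ) (RatFunc ℂ)
    (Polynomial.C a * Polynomial.X) by simp]
  simp [ratFun, RatFunc.eval, -map_mul]

theorem ratDegree_C_mul_X_le (a : ℂ) : ratDegree (RatFunc.C a * RatFunc.X) ≤ 1 := by
  rw [show RatFunc.C a * RatFunc.X = algebraMap (Polynomial ℂ) (RatFunc ℂ)
    (Polynomial.C a * Polynomial.X) by simp, ratDegree, RatFunc.num_algebraMap,
    RatFunc.denom_algebraMap]
  simpa using Polynomial.natDegree_C_mul_le a Polynomial.X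

theorem sphereValue_ratFun_C_mul_X (a z : ℂ) :
    sphereValue (ratFun (RatFunc.C a * RatFunc.X)) z = ((a * z : ℂ) : OnePoint ℂ) := by
  rw [show ratFun (RatFunc.C a * RatFunc.X) = fun z => a * z from funext (ratFun_C_mul_X a)]
  exact sphereValue_eq_of_continuousAt (continuous_const_mul a).continuousAt

/-- A limit of a subsequence of `n z` would be `0` at the origin and `∞` elsewhere, hence not
continuous. -/
theorem not_isNormalFamily_C_mul_X_ball :
    ¬ IsNormalFamily (ratFun '' {R | ∃ n : ℕ, 1 ≤ n ∧ R = RatFunc.C (n : ℂ) * RatFunc.X})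
      (Metric.ball 0 1) := by
  intro h
  obtain ⟨s, hs, φ, hφ⟩ := h (fun n => ratFun (RatFunc.C ((n + 1 : ℕ) : ℂ) * RatFunc.X))
    fun n => ⟨_, ⟨n + 1, Nat.succ_pos n, rfl⟩, rfl⟩
  simp only [TendstoSphericallyLocallyUniformlyOn, sphereValue_ratFun_C_mul_X] at hφ
  have h0 : (0 : ℂ) ∈ Metric.ball (0 : ℂ) 1 := Metric.mem_ball_self one_pos
  have hcont : ContinuousAt (fun z => stereo (φ z)) 0 := by
    refine ContinuousOn.continuousAt (hφ.continuousOn (Frequently.of_forall fun n => ?_))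
      (Metric.ball_mem_nhds 0 one_pos)
    exact (continuous_stereo.comp
      (OnePoint.continuous_coe.comp (continuous_const_mul _))).continuousOn
  have hzero : stereo (φ 0) = stereo ((0 : ℂ) : OnePoint ℂ) := by
    refine tendsto_nhds_unique (hφ.tendsto_at h0) ?_
    simp
  have hinfty : ∀ z ∈ Metric.ball (0 : ℂ) 1, z ≠ 0 → stereo (φ z) = stereo OnePoint.infty := by
    intro z hz hz0
    refine tendsto_nhds_unique (hφ.tendsto_at hz) ((continuous_stereo.tendsto _).comp ?_)
    refine OnePoint.tendsto_coe_infty.comp ?_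
    rw [Filter.coclosedCompact_eq_cocompact, ← Metric.cobounded_eq_cocompact,
      ← tendsto_norm_atTop_iff_cobounded]
    simp only [norm_mul, Complex.norm_natCast]
    refine Tendsto.atTop_mul_const (norm_pos_iff.2 hz0) ?_
    exact tendsto_natCast_atTop_atTop.comp ((tendsto_add_atTop_nat 1).comp hs.tendsto_atTop)
  have hlim : Tendsto (fun z => stereo (φ z)) (𝓝[≠] 0) (𝓝 (stereo OnePoint.infty)) := by
    refine tendsto_const_nhds.congr' ?_
    filter_upwards [self_mem_nhdsWithin, nhdsWithin_le_nhds (Metric.ball_mem_nhds (0 : ℂ) one_pos)]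
      with z hz hzb
    exact (hinfty z hzb hz).symm
  have heq := tendsto_nhds_unique (hcont.tendsto.mono_left nhdsWithin_le_nhds) hlim
  exact OnePoint.infty_ne_coe 0 (stereo_injective (heq.symm.trans hzero))

theorem theorem1p4 :
    (∀ (D : Set ℂ), IsOpen D → IsConnected D →
      ∀ (m : ℕ) (𝓡 : Set (RatFunc ℂ)) (𝓖 : Set (ℂ → ℂ)) (a₁ a₂ a₃ : OnePoint ℂ),
        (∀ R ∈ 𝓡, ratDegree R ≤ m) →
        (∀ g ∈ 𝓖, MeromorphicOn g D) →
        a₁ ≠ a₂ → a₁ ≠ a₃ → a₂ ≠ a₃ →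
        IsNormalFamily 𝓖 D →
        (∀ R ∈ 𝓡, ∃ g ∈ 𝓖, SharesPartially (ratFun R) g a₁ D ∧
          SharesPartially (ratFun R) g a₂ D ∧ SharesPartially (ratFun R) g a₃ D) →
        IsNormalFamily (ratFun '' 𝓡) D) ∧
    -- Two values do not suffice: `R_n(z) = n z` and `g_n(z) = z ^ n`, `n ≥ 1`, in the unit disc.
    (∃ (𝓡 : Set (RatFunc ℂ)) (𝓖 : Set (ℂ → ℂ)),
      𝓡 = {R | ∃ n : ℕ, 1 ≤ n ∧ R = RatFunc.C (n : ℂ) * RatFunc.X} ∧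
      𝓖 = {g | ∃ n : ℕ, 1 ≤ n ∧ g = fun z => z ^ n} ∧
      (∀ R ∈ 𝓡, ratDegree R ≤ 1) ∧
      (∀ g ∈ 𝓖, MeromorphicOn g (Metric.ball 0 1)) ∧
      IsNormalFamily 𝓖 (Metric.ball 0 1) ∧
      (∀ R ∈ 𝓡, ∃ g ∈ 𝓖,
        SharesPartially (ratFun R) g ((0 : ℂ) : OnePoint ℂ) (Metric.ball 0 1) ∧
        SharesPartially (ratFun R) g OnePoint.infty (Metric.ball 0 1)) ∧
      ¬ IsNormalFamily (ratFun '' 𝓡) (Metric.ball 0 1)) := by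
  refine ⟨fun D hD _ m 𝓡 𝓖 a₁ a₂ a₃ h𝓡 h𝓖 h₁₂ h₁₃ h₂₃ hnorm hshare =>
    isNormalFamily_of_sharesPartially hD h𝓡 h𝓖 h₁₂ h₁₃ h₂₃ hnorm hshare,
    _, _, rfl, rfl, ?_, ?_, isNormalFamily_pow_ball, ?_, not_isNormalFamily_C_mul_X_ball⟩
  · rintro R ⟨n, -, rfl⟩
    exact ratDegree_C_mul_X_le _
  · rintro g ⟨n, -, rfl⟩ z -
    exact (MeromorphicAt.id z).pow n
  · rintro R ⟨n, hn, rfl⟩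
    have hn0 : n ≠ 0 := Nat.one_le_iff_ne_zero.1 hn
    refine ⟨fun z => z ^ n, ⟨n, hn, rfl⟩, ?_, ?_⟩
    · rintro z ⟨hz, hval⟩
      rw [sphereValue_ratFun_C_mul_X, OnePoint.coe_eq_coe] at hval
      have hz0 : z = 0 := by simpa [hn0] using hval
      exact ⟨hz, by rw [sphereValue_pow, hz0, zero_pow hn0]⟩
    · rintro z ⟨hz, hval⟩
      rw [sphereValue_ratFun_C_mul_X] at hval
      exact absurd hval (OnePoint.coe_ne_infty _)
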